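/- Let $r,s\ge 3$ and $\ell\ge 1$ be integers with $r$ even and $s$ odd, and let $D_{r,s,\ell}$ be the dumbbell graph, obtained from two vertex-disjoint cycles $C_r$ and $C_s$ by choosing one vertex on each and joining these two vertices by a path of length $\ell$. A complex unit gain graph $\Phi=(D_{r,s,\ell},\varphi)$ assigns to every oriented edge $(u,v)$ of $D_{r,s,\ell}$ a complex number $\varphi(u,v)$ with $|\varphi(u,v)|=1$ and $\varphi(v,u)=\varphi(u,v)^{-1}$. Its adjacency matrix $A(\Phi)$ is the Hermitian matrix with entry $\varphi(u,v)$ if $u$ and $v$ are adjacent and $0$ otherwise, and its energy $E(\Phi)$ is the sum of the absolute values of the eigenvalues of $A(\Phi)$, counted with multiplicity. Let $\gamma_r$ and $\gamma_s$ be the gains of the cycles $C_r$ and $C_s$ in $\Phi$, that is, the products of the gains of the oriented edges met when going once around the cycle (the real part does not depend on the direction or the starting vertex), and put $$\alpha=(-1)^{r/2}\operatorname{Re}(\gamma_r),\qquad \beta=(-1)^{(s+1)/2}\operatorname{Re}(\gamma_s).$$ Theorem. The minimum of $E(\Phi)$ over all complex unit gain graphs $\Phi$ on $D_{r,s,\ell}$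 is attained, and $\Phi$ attains it if and only if $\alpha=1$ and $\beta=0$. -/

import Mathlib

/-- A complex unit gain graph on the simple graph `G`: every oriented edge `u → v` carries a complex
number of modulus one, and reversing the orientation inverts it. -/
structure UnitGainGraph {V : Type*} (G : SimpleGraph V) where
  /-- The gain of an oriented edge. -/
  gain : G.Dart → Circle
  gain_symm : ∀ d : G.Dart, gain d.symm = (gain d)⁻¹

namespace UnitGainGraph

variable {V : Type*} {G : SimpleGraph V}

open Classical in
/-- The Hermitian adjacency matrix: the gain of `u → v` if `u` and `v` are adjacent, otherwise `0`. -/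
noncomputable def adjMatrix (Φ : UnitGainGraph G) : Matrix V V ℂ :=
  Matrix.of fun u v => if h : G.Adj u v then (Φ.gain ⟨(u, v), h⟩ : ℂ) else 0

theorem isHermitian_adjMatrix (Φ : UnitGainGraph G) : Φ.adjMatrix.IsHermitian := by
  ext u v
  simp only [adjMatrix, Matrix.conjTranspose_apply, Matrix.of_apply]
  by_cases h : G.Adj u v
  · have h' : G.Adj v u := h.symm
    have key := Φ.gain_symm ⟨(u, v), h⟩
    have e : (SimpleGraph.Dart.symm ⟨(u, v), h⟩ : G.Dart) = ⟨(v, u), h'⟩ := rfl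
    rw [e] at key
    rw [dif_pos h, dif_pos h', key, Circle.coe_inv_eq_conj]
    simp
  · have h' : ¬ G.Adj v u := fun k => h k.symm
    simp [h, h']

/-- The energy: the sum of the absolute values of the eigenvalues of the adjacency matrix,
counted with multiplicity. -/
noncomputable def energy [Fintype V] [DecidableEq V] (Φ : UnitGainGraph G) : ℝ :=
  ∑ j, |Φ.isHermitian_adjMatrix.eigenvalues j|

end UnitGainGraph

theorem cycleGraph_adj_finRotate {k : ℕ} (hk : 3 ≤ k) (i : Fin k) :
    (SimpleGraph.cycleGraph k).Adj i (finRotate k i) := by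
  obtain ⟨m, rfl⟩ : ∃ m, k = m + 2 := ⟨k - 2, by omega⟩
  rw [finRotate_apply, SimpleGraph.cycleGraph_adj]
  right
  simp

/-- The gain `φ(c₀,c₁) φ(c₁,c₂) ⋯ φ(c_{k-1},c₀)` of a cycle `c₀, c₁, …, c_{k-1}` of `G`, given as a
copy in `G` of the cycle graph on `Fin k` (`finRotate k` is the map `i ↦ i + 1` modulo `k`). -/
noncomputable def UnitGainGraph.cycleGain {V : Type*} {G : SimpleGraph V} (Φ : UnitGainGraph G)
    {k : ℕ} (hk : 3 ≤ k) (c : SimpleGraph.Copy (SimpleGraph.cycleGraph k) G) : Circle :=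
  ∏ i : Fin k, Φ.gain ⟨(c i, c (finRotate k i)), c.toHom.map_adj (cycleGraph_adj_finRotate hk i)⟩

/-- The vertices of the dumbbell graph: those of the cycle `C_r`, the `ℓ - 1` inner vertices of the
connecting path, and those of the cycle `C_s`. -/
abbrev DumbbellVertex (r s ℓ : ℕ) : Type := Fin r ⊕ Fin (ℓ - 1) ⊕ Fin s

/-- Adjacency in the dumbbell graph: the path of length `ℓ` runs from vertex `0` of `C_r` through the
inner vertices `0, …, ℓ - 2` to vertex `0` of `C_s`; for `ℓ = 1` it is a single edge. -/
def dumbbellAdj (r s ℓ : ℕ) : DumbbellVertex r s ℓ → DumbbellVertex r s ℓ → Prop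
  | .inl i, .inl j => (SimpleGraph.cycleGraph r).Adj i j
  | .inr (.inl i), .inr (.inl j) => (SimpleGraph.pathGraph (ℓ - 1)).Adj i j
  | .inr (.inr i), .inr (.inr j) => (SimpleGraph.cycleGraph s).Adj i j
  | .inl i, .inr (.inl j) => i.val = 0 ∧ j.val = 0
  | .inr (.inl j), .inl i => i.val = 0 ∧ j.val = 0
  | .inr (.inl j), .inr (.inr k) => j.val + 1 = ℓ - 1 ∧ k.val = 0
  | .inr (.inr k), .inr (.inl j) => j.val + 1 = ℓ - 1 ∧ k.val = 0
  | .inl i, .inr (.inr k) => ℓ = 1 ∧ i.val = 0 ∧ k.val = 0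
  | .inr (.inr k), .inl i => ℓ = 1 ∧ i.val = 0 ∧ k.val = 0

/-- The dumbbell graph `D_{r,s,ℓ}` (for `r, s ≥ 3` and `ℓ ≥ 1`): two vertex disjoint cycles `C_r` and
`C_s`, one vertex of each being joined by a path of length `ℓ`. -/
def dumbbellGraph (r s ℓ : ℕ) : SimpleGraph (DumbbellVertex r s ℓ) where
  Adj := dumbbellAdj r s ℓ
  symm := ⟨by
    rintro (i | i | i) (j | j | j) h
    · exact SimpleGraph.Adj.symm (G := SimpleGraph.cycleGraph r) h
    · exact h
    · exact h
    · exact h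
    · exact SimpleGraph.Adj.symm (G := SimpleGraph.pathGraph (ℓ - 1)) h
    · exact h
    · exact h
    · exact h
    · exact SimpleGraph.Adj.symm (G := SimpleGraph.cycleGraph s) h⟩
  loopless := ⟨by
    rintro (i | i | i) h
    · exact (SimpleGraph.cycleGraph r).loopless.irrefl i h
    · exact (SimpleGraph.pathGraph (ℓ - 1)).loopless.irrefl i h
    · exact (SimpleGraph.cycleGraph s).loopless.irrefl i h⟩

/-- The cycle `C_r` of the dumbbell graph. -/
def dumbbellLeftCycle (r s ℓ : ℕ) :
    SimpleGraph.Copy (SimpleGraph.cycleGraph r) (dumbbellGraph r s ℓ) :=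
  ⟨⟨fun i => .inl i, fun h => h⟩, fun _ _ h => Sum.inl_injective h⟩

/-- The cycle `C_s` of the dumbbell graph. -/
def dumbbellRightCycle (r s ℓ : ℕ) :
    SimpleGraph.Copy (SimpleGraph.cycleGraph s) (dumbbellGraph r s ℓ) :=
  ⟨⟨fun i => .inr (.inr i), fun h => h⟩,
    fun _ _ h => Sum.inr_injective (Sum.inr_injective h)⟩

/-- For even `r`: `α = (-1)^{r/2} Re γ_r`, where `γ_r` is the gain of the cycle `C_r`. -/
noncomputable def mixedAlpha {r s ℓ : ℕ} (hr : 3 ≤ r) (Φ : UnitGainGraph (dumbbellGraph r s ℓ)) : ℝ :=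
  (-1) ^ (r / 2) * (Φ.cycleGain hr (dumbbellLeftCycle r s ℓ) : ℂ).re

/-- For odd `s`: `β = (-1)^{(s+1)/2} Re γ_s`, where `γ_s` is the gain of the cycle `C_s`. -/
noncomputable def mixedBeta {r s ℓ : ℕ} (hs : 3 ≤ s) (Φ : UnitGainGraph (dumbbellGraph r s ℓ)) : ℝ :=
  (-1) ^ ((s + 1) / 2) * (Φ.cycleGain hs (dumbbellRightCycle r s ℓ) : ℂ).re

/-!
The Coulson–Jacobs formula writes `π E(Φ)` as the integral over `x > 0` of
`log (|det (i x I - A(Φ))| ^ 2 / x ^ (2 N))`, where `N` is the number of vertices, so the energy is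
strictly increasing in the family of numbers `|det (i x I - A(Φ))|`, `x > 0`. Deleting the edge that
joins `C_r` to the connecting path, then unrolling the path and the cycles, expresses this
determinant through Lucas sequences in `i x` and the real parts of the two cycle gains. Factoring
out the powers of `i`, which become signs for even `r` and a factor `i` for odd `s`, leaves Lucas
sequences in `x` with positive terms, and
`|det (i x I - A(Φ))| ^ 2 = F(α) ^ 2 + 4 β ^ 2 G(α) ^ 2`, where `F` and `G` are affine in `α` and
positive and decreasing for `α ≤ 1`. For every `x` this is smallest exactly at `α = 1`, `β = 0`.
-/

section CoulsonJacobs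

open MeasureTheory Set Filter Topology Real

theorem setIntegral_lt_setIntegral_of_forall_lt {X : Type*} [MeasurableSpace X] {μ : Measure X}
    {s : Set X} {f g : X → ℝ} (hs : MeasurableSet s) (hμ : 0 < μ s) (hf : IntegrableOn f s μ)
    (hg : IntegrableOn g s μ) (h : ∀ x ∈ s, f x < g x) :
    ∫ x in s, f x ∂μ < ∫ x in s, g x ∂μ := by
  rw [← sub_pos, ← integral_sub hg hf, setIntegral_pos_iff_support_of_nonneg_ae
    (ae_restrict_of_forall_mem hs fun x hx => (sub_pos.2 (h x hx)).le) (hg.sub hf)]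
  exact hμ.trans_le (measure_mono fun x hx => ⟨(sub_pos.2 (h x hx)).ne', hx⟩)

/-- The primitive of `x ↦ log (1 + a ^ 2 / x ^ 2)` on `(0, ∞)` that vanishes at `0`. -/
noncomputable def logOneAddSqDivSqPrimitive (a x : ℝ) : ℝ :=
  x * log (1 + a ^ 2 / x ^ 2) + 2 * (|a| * arctan (x / |a|))

theorem logOneAddSqDivSqPrimitive_zero (a : ℝ) : logOneAddSqDivSqPrimitive a 0 = 0 := by
  simp [logOneAddSqDivSqPrimitive]

theorem hasDerivAt_logOneAddSqDivSqPrimitive (a : ℝ) {x : ℝ} (hx : 0 < x) :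
    HasDerivAt (logOneAddSqDivSqPrimitive a) (log (1 + a ^ 2 / x ^ 2)) x := by
  have hlog := ((((hasDerivAt_pow 2 x).fun_inv (by positivity)).const_mul (a ^ 2)).const_add 1).log
    (x := x) (by positivity)
  have harctan := (((hasDerivAt_id x).div_const |a|).arctan.const_mul |a|).const_mul 2
  refine (((hasDerivAt_id x).mul hlog).add harctan).congr_deriv ?_
  rcases eq_or_ne a 0 with rfl | ha
  · simp
  · have : 0 < |a| := abs_pos.2 ha
    simp only [id, ← sq_abs a, ← div_eq_mul_inv]
    field_simp
    ring

theorem continuous_logOneAddSqDivSqPrimitive (a : ℝ) :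
    Continuous (logOneAddSqDivSqPrimitive a) := by
  have hlog : Continuous fun x : ℝ => x * log (1 + a ^ 2 / x ^ 2) := by
    rcases eq_or_ne a 0 with rfl | ha
    · simpa using continuous_const
    have hsplit : (fun x : ℝ => x * log (1 + a ^ 2 / x ^ 2)) =
        fun x => x * log (x ^ 2 + a ^ 2) - 2 * (x * log x) := by
      ext x
      rcases eq_or_ne x 0 with rfl | hx
      · simp
      rw [one_add_div (by positivity), log_div (by positivity) (by positivity), log_pow]
      push_cast
      ring
    rw [hsplit]
    exact (continuous_id.mul (Continuous.log (by fun_prop) fun x => by positivity)).sub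
      (continuous_mul_log.const_mul 2)
  exact hlog.add ((continuous_arctan.comp (continuous_id.div_const _)).const_mul _ |>.const_mul 2)

theorem tendsto_mul_log_one_add_sq_div_sq (a : ℝ) :
    Tendsto (fun x : ℝ => x * log (1 + a ^ 2 / x ^ 2)) atTop (𝓝 0) := by
  refine tendsto_of_tendsto_of_tendsto_of_le_of_le' tendsto_const_nhds
    (tendsto_const_nhds (x := a ^ 2) |>.div_atTop tendsto_id) ?_ ?_
  · filter_upwards [eventually_gt_atTop 0] with x hx
    exact mul_nonneg hx.le (log_nonneg (le_add_of_nonneg_right (by positivity)))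
  · filter_upwards [eventually_gt_atTop 0] with x hx
    calc x * log (1 + a ^ 2 / x ^ 2)
        ≤ x * (1 + a ^ 2 / x ^ 2 - 1) := by gcongr; exact log_le_sub_one_of_pos (by positivity)
      _ = a ^ 2 / x := by field_simp; ring

theorem tendsto_logOneAddSqDivSqPrimitive (a : ℝ) :
    Tendsto (logOneAddSqDivSqPrimitive a) atTop (𝓝 (π * |a|)) := by
  have harctan : Tendsto (fun x : ℝ => |a| * arctan (x / |a|)) atTop (𝓝 (|a| * (π / 2))) := by
    rcases eq_or_ne a 0 with rfl | ha
    · simp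
    · exact ((tendsto_nhds_of_tendsto_nhdsWithin tendsto_arctan_atTop).comp
        (tendsto_id.atTop_div_const (abs_pos.2 ha))).const_mul _
  rw [show π * |a| = 0 + 2 * (|a| * (π / 2)) by ring]
  exact (tendsto_mul_log_one_add_sq_div_sq a).add (harctan.const_mul 2)

theorem log_one_add_sq_div_sq_nonneg (a x : ℝ) : 0 ≤ log (1 + a ^ 2 / x ^ 2) :=
  log_nonneg (le_add_of_nonneg_right (by positivity))

theorem integrableOn_log_one_add_sq_div_sq (a : ℝ) :
    IntegrableOn (fun x : ℝ => log (1 + a ^ 2 / x ^ 2)) (Ioi 0) :=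
  integrableOn_Ioi_deriv_of_nonneg (continuous_logOneAddSqDivSqPrimitive a).continuousWithinAt
    (fun _ hx => hasDerivAt_logOneAddSqDivSqPrimitive a hx)
    (fun x _ => log_one_add_sq_div_sq_nonneg a x) (tendsto_logOneAddSqDivSqPrimitive a)

theorem integral_log_one_add_sq_div_sq (a : ℝ) :
    ∫ x in Ioi (0 : ℝ), log (1 + a ^ 2 / x ^ 2) = π * |a| := by
  rw [integral_Ioi_of_hasDerivAt_of_nonneg
    (continuous_logOneAddSqDivSqPrimitive a).continuousWithinAt
    (fun _ hx => hasDerivAt_logOneAddSqDivSqPrimitive a hx)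
    (fun x _ => log_one_add_sq_div_sq_nonneg a x) (tendsto_logOneAddSqDivSqPrimitive a),
    logOneAddSqDivSqPrimitive_zero, sub_zero]

theorem normSq_det_scalar_I_mul_sub {V : Type*} [Fintype V] [DecidableEq V] {A : Matrix V V ℂ}
    (hA : A.IsHermitian) (x : ℝ) :
    Complex.normSq (Matrix.scalar V (Complex.I * x) - A).det =
      ∏ i, (x ^ 2 + hA.eigenvalues i ^ 2) := by
  rw [← Matrix.eval_charpoly, hA.charpoly_eq, Polynomial.eval_prod, map_prod]
  refine Finset.prod_congr rfl fun i _ => ?_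
  simp only [Complex.coe_algebraMap, Polynomial.eval_sub, Polynomial.eval_X, Polynomial.eval_C,
    Complex.normSq_apply, Complex.sub_re, Complex.mul_re, Complex.I_re, Complex.ofReal_re,
    Complex.I_im, Complex.ofReal_im, Complex.sub_im, Complex.mul_im]
  ring

end CoulsonJacobs

section Energy

open MeasureTheory Set Real

namespace UnitGainGraph

variable {V : Type*} {G : SimpleGraph V} [Fintype V] [DecidableEq V]

/-- The characteristic matrix `z I - A(Φ)`, whose determinant is the characteristic polynomial of
`Φ` at `z`. -/
noncomputable def charMatrix (Φ : UnitGainGraph G) (z : ℂ) : Matrix V V ℂ :=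
  Matrix.scalar V z - Φ.adjMatrix

/-- The integrand of the Coulson–Jacobs formula for the energy, up to the factor `π`. -/
noncomputable def coulsonIntegrand (Φ : UnitGainGraph G) (x : ℝ) : ℝ :=
  log (Complex.normSq (Φ.charMatrix (Complex.I * x)).det / (x ^ 2) ^ Fintype.card V)

theorem coulsonIntegrand_eq_sum (Φ : UnitGainGraph G) {x : ℝ} (hx : 0 < x) :
    Φ.coulsonIntegrand x =
      ∑ i, log (1 + Φ.isHermitian_adjMatrix.eigenvalues i ^ 2 / x ^ 2) := by
  rw [coulsonIntegrand, charMatrix, normSq_det_scalar_I_mul_sub Φ.isHermitian_adjMatrix,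
    ← Finset.card_univ, ← Finset.prod_const, ← Finset.prod_div_distrib,
    log_prod fun i _ => by positivity]
  exact Finset.sum_congr rfl fun i _ => by rw [one_add_div (by positivity)]

theorem integrableOn_coulsonIntegrand (Φ : UnitGainGraph G) :
    IntegrableOn Φ.coulsonIntegrand (Ioi 0) :=
  IntegrableOn.congr_fun (integrable_finsetSum _ fun _ _ => integrableOn_log_one_add_sq_div_sq _)
    (fun _ hx => (Φ.coulsonIntegrand_eq_sum hx).symm) measurableSet_Ioi

theorem integral_coulsonIntegrand (Φ : UnitGainGraph G) :
    ∫ x in Ioi 0, Φ.coulsonIntegrand x = π * Φ.energy := by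
  rw [setIntegral_congr_fun measurableSet_Ioi fun _ hx => Φ.coulsonIntegrand_eq_sum hx,
    integral_finsetSum _ fun _ _ => integrableOn_log_one_add_sq_div_sq _, energy, Finset.mul_sum]
  exact Finset.sum_congr rfl fun i _ => integral_log_one_add_sq_div_sq _

theorem normSq_det_charMatrix_pos (Φ : UnitGainGraph G) {x : ℝ} (hx : 0 < x) :
    0 < Complex.normSq (Φ.charMatrix (Complex.I * x)).det := by
  rw [charMatrix, normSq_det_scalar_I_mul_sub Φ.isHermitian_adjMatrix]
  exact Finset.prod_pos fun i _ => by positivity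

variable {Φ Ψ : UnitGainGraph G}

theorem energy_eq_of_normSq_det_charMatrix_eq (h : ∀ x : ℝ, 0 < x →
    Complex.normSq (Φ.charMatrix (Complex.I * x)).det =
      Complex.normSq (Ψ.charMatrix (Complex.I * x)).det) :
    Φ.energy = Ψ.energy := by
  refine mul_left_cancel₀ pi_ne_zero ?_
  rw [← integral_coulsonIntegrand, ← integral_coulsonIntegrand]
  exact setIntegral_congr_fun measurableSet_Ioi fun x hx => by
    rw [coulsonIntegrand, coulsonIntegrand, h x hx]

theorem energy_lt_of_normSq_det_charMatrix_lt (h : ∀ x : ℝ, 0 < x →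
    Complex.normSq (Φ.charMatrix (Complex.I * x)).det <
      Complex.normSq (Ψ.charMatrix (Complex.I * x)).det) :
    Φ.energy < Ψ.energy := by
  refine lt_of_mul_lt_mul_left ?_ pi_pos.le
  rw [← integral_coulsonIntegrand, ← integral_coulsonIntegrand]
  refine setIntegral_lt_setIntegral_of_forall_lt measurableSet_Ioi (by simp)
    Φ.integrableOn_coulsonIntegrand Ψ.integrableOn_coulsonIntegrand fun x hx => ?_
  have hx : 0 < x := hx
  exact log_lt_log (div_pos (Φ.normSq_det_charMatrix_pos hx) (by positivity))
    (div_lt_div_of_pos_right (h x hx) (by positivity))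

end UnitGainGraph

end Energy

section Determinants

open Matrix

variable {R : Type*} [CommRing R]

theorem det_updateRow_add_smul_single {ι : Type*} [Fintype ι] [DecidableEq ι] (M : Matrix ι ι R)
    (i j : ι) (t : R) :
    (M.updateRow i (M i + t • Pi.single j 1)).det =
      M.det + t * (M.updateRow i (Pi.single j 1)).det := by
  rw [det_updateRow_add, det_updateRow_smul, updateRow_eq_self]

section Bridge

variable {ι κ : Type*} [Fintype ι] [DecidableEq ι] [Fintype κ] [DecidableEq κ]
  (A : Matrix ι ι R) (D : Matrix κ κ R) (u : ι) (v : κ)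

theorem det_fromBlocks_updateRow_single_swap :
    ((fromBlocks (A.updateRow u 0) (single u v 1) 0 D).updateRow (.inr v)
      (Pi.single (.inl u) 1)).det = -(A.adjugate u u * D.adjugate v v) := by
  have hswap : (fromBlocks (A.updateRow u 0) (single u v 1) 0 D).updateRow (.inr v)
      (Pi.single (.inl u) 1) =
      (fromBlocks (A.updateRow u (Pi.single u 1)) 0 0 (D.updateRow v (Pi.single v 1))).submatrix
        (Equiv.swap (.inl u) (.inr v)) id := by
    ext i j
    rcases eq_or_ne i (.inl u) with rfl | hu
    · rcases j with j | j <;> simp [updateRow_apply, single_apply, Pi.single_apply, eq_comm]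
    rcases eq_or_ne i (.inr v) with rfl | hv
    · rcases j with j | j <;> simp [updateRow_apply, Pi.single_apply]
    rw [submatrix_apply, Equiv.swap_apply_of_ne_of_ne hu hv]
    rcases i with i | i <;> rcases j with j | j <;> simp_all [updateRow_apply, eq_comm]
  rw [hswap, det_permute, Equiv.Perm.sign_swap (by simp), det_fromBlocks_zero₂₁, adjugate_apply,
    adjugate_apply]
  simp

theorem det_fromBlocks_single_single (b c : R) :
    (fromBlocks A (single u v b) (single v u c) D).det =
      A.det * D.det - b * c * (A.adjugate u u * D.adjugate v v) := by
  have hrow : fromBlocks A (single u v b) (single v u c) D =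
      (fromBlocks A 0 (single v u c) D).updateRow (.inl u)
        (fromBlocks A 0 (single v u c) D (.inl u) + b • Pi.single (.inr v) 1) := by
    ext (i | i) (j | j) <;>
      simp +contextual [updateRow_apply, single_apply, Pi.single_apply, ite_and, eq_comm]
  have hrow' : (fromBlocks A 0 (single v u c) D).updateRow (.inl u) (Pi.single (.inr v) 1) =
      (fromBlocks (A.updateRow u 0) (single u v 1) 0 D).updateRow (.inr v)
        (fromBlocks (A.updateRow u 0) (single u v 1) 0 D (.inr v) + c • Pi.single (.inl u) 1) := by
    ext (i | i) (j | j) <;>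
      simp +contextual [updateRow_apply, single_apply, Pi.single_apply, ite_and, eq_comm]
  have hzero : (A.updateRow u 0).det = 0 := det_eq_zero_of_row_eq_zero u (by simp)
  rw [hrow, det_updateRow_add_smul_single, det_fromBlocks_zero₁₂, hrow',
    det_updateRow_add_smul_single, det_fromBlocks_zero₂₁, hzero,
    det_fromBlocks_updateRow_single_swap]
  ring

end Bridge

theorem det_eq_mul_det_sub_sum_adjugate {n : ℕ} (M : Matrix (Fin (n + 2)) (Fin (n + 2)) R) :
    M.det = M 0 0 * (M.submatrix Fin.succ Fin.succ).det -
      ∑ i : Fin (n + 1), ∑ j : Fin (n + 1),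
        M 0 i.succ * (M.submatrix Fin.succ Fin.succ).adjugate i j * M j.succ 0 := by
  rw [det_succ_row_zero, Fin.sum_univ_succ, sub_eq_add_neg, ← Finset.sum_neg_distrib]
  congr 1
  · simp
  refine Finset.sum_congr rfl fun i _ => ?_
  rw [det_succ_column_zero, Finset.mul_sum, ← Finset.sum_neg_distrib]
  refine Finset.sum_congr rfl fun j _ => ?_
  have hminor : ((M.submatrix Fin.succ i.succ.succAbove).submatrix j.succAbove Fin.succ) =
      (M.submatrix Fin.succ Fin.succ).submatrix j.succAbove i.succAbove := by
    ext
    simp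
  rw [hminor, adjugate_fin_succ_eq_det_submatrix]
  simp only [Fin.val_succ, pow_succ, pow_add, submatrix_apply, Fin.succAbove_ne_zero_zero, ne_eq,
    Fin.succ_ne_zero, not_false_eq_true, submatrix_submatrix]
  ring

theorem adjugate_apply_self_eq_det_submatrix {V W : Type*} [Fintype V] [DecidableEq V] [Fintype W]
    [DecidableEq W] (M : Matrix V V R) {f : W → V} {v : V} (hf : f.Injective)
    (hrange : Set.range f = {v}ᶜ) : M.adjugate v v = (M.submatrix f f).det := by
  have hfv (w : W) : f w ≠ v := by
    have : f w ∈ ({v} : Set V)ᶜ := hrange ▸ Set.mem_range_self w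
    simpa using this
  let e : Unit ⊕ W ≃ V := Equiv.ofBijective (Sum.elim (fun _ => v) f)
    ⟨(Function.injective_of_subsingleton _).sumElim hf fun _ w => (hfv w).symm, by
      rw [← Set.range_eq_univ, Set.Sum.elim_range, Set.range_const, hrange, Set.union_compl_self]⟩
  have hinl (i : Unit) : e (.inl i) = v := rfl
  have hinr (w : W) : e (.inr w) = f w := rfl
  have hblocks : (M.updateRow v (Pi.single v 1)).submatrix e e =
      fromBlocks 1 0 (M.submatrix f fun _ => v) (M.submatrix f f) := by
    ext (i | i) (j | j) <;> simp [hinl, hinr, updateRow_apply, hfv]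
  rw [adjugate_apply, ← det_submatrix_equiv_self e, hblocks, det_fromBlocks_zero₁₂,
    det_one, one_mul]

end Determinants

section LucasSequence

variable {R : Type*} [CommRing R]

/-- The Lucas sequence `u` with parameters `P` and `Q`, starting at `u 0 = a` and `u 1 = b` and
satisfying `u (n + 2) = P * u (n + 1) - Q * u n`. -/
def lucasSeq (P Q a b : R) : ℕ → R
  | 0 => a
  | 1 => b
  | n + 2 => P * lucasSeq P Q a b (n + 1) - Q * lucasSeq P Q a b n

/-- The Lucas sequence `U_n(P, Q)` of the first kind. -/
def lucasU (P Q : R) : ℕ → R :=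
  lucasSeq P Q 0 1

/-- The Lucas sequence `V_n(P, Q)` of the second kind. -/
def lucasV (P Q : R) : ℕ → R :=
  lucasSeq P Q 2 P

theorem lucasSeq_sub (P Q a b t : R) : ∀ n : ℕ,
    lucasSeq P Q a (b - t) n = lucasSeq P Q a b n - t * lucasU P Q n
  | 0 => by simp [lucasU, lucasSeq]
  | 1 => by simp [lucasU, lucasSeq]
  | n + 2 => by
    rw [lucasSeq, lucasSeq_sub P Q a b t (n + 1), lucasSeq_sub P Q a b t n]
    simp only [lucasU, lucasSeq]
    ring

theorem lucasSeq_mul (P Q a b t : R) : ∀ n : ℕ,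
    lucasSeq P Q (t * a) (t * b) n = t * lucasSeq P Q a b n
  | 0 => rfl
  | 1 => rfl
  | n + 2 => by
    simp only [lucasSeq, lucasSeq_mul P Q a b t (n + 1), lucasSeq_mul P Q a b t n]
    ring

theorem lucasSeq_mul_sq (P Q a b t : R) : ∀ n : ℕ,
    lucasSeq (t * P) (t ^ 2 * Q) a (t * b) n = t ^ n * lucasSeq P Q a b n
  | 0 => by simp [lucasSeq]
  | 1 => by simp [lucasSeq]
  | n + 2 => by
    simp only [lucasSeq, lucasSeq_mul_sq P Q a b t (n + 1), lucasSeq_mul_sq P Q a b t n]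
    ring

theorem lucasSeq_succ_eq (P Q a b : R) : ∀ n : ℕ,
    lucasSeq P Q a b (n + 1) = b * lucasU P Q (n + 1) - Q * a * lucasU P Q n
  | 0 => by simp [lucasU, lucasSeq]
  | 1 => by
    simp only [lucasU, lucasSeq]
    ring
  | n + 2 => by
    rw [lucasSeq, lucasSeq_succ_eq P Q a b (n + 1), lucasSeq_succ_eq P Q a b n]
    simp only [lucasU, lucasSeq]
    ring

theorem map_lucasSeq {S : Type*} [CommRing S] (f : R →+* S) (P Q a b : R) : ∀ n : ℕ,
    f (lucasSeq P Q a b n) = lucasSeq (f P) (f Q) (f a) (f b) n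
  | 0 => rfl
  | 1 => rfl
  | n + 2 => by
    simp only [lucasSeq, map_sub, map_mul, map_lucasSeq f P Q a b (n + 1),
      map_lucasSeq f P Q a b n]

@[norm_cast]
theorem ofReal_lucasSeq (P Q a b : ℝ) (n : ℕ) :
    ((lucasSeq P Q a b n : ℝ) : ℂ) = lucasSeq (P : ℂ) Q a b n :=
  map_lucasSeq Complex.ofRealHom P Q a b n

@[norm_cast]
theorem ofReal_lucasU (P Q : ℝ) (n : ℕ) : ((lucasU P Q n : ℝ) : ℂ) = lucasU (P : ℂ) Q n := by
  simp [lucasU, ofReal_lucasSeq]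

@[norm_cast]
theorem ofReal_lucasV (P Q : ℝ) (n : ℕ) : ((lucasV P Q n : ℝ) : ℂ) = lucasV (P : ℂ) Q n := by
  simp [lucasV, ofReal_lucasSeq]

theorem lucasSeq_neg_one_nonneg {x a b : ℝ} (hx : 0 ≤ x) (ha : 0 ≤ a) (hb : 0 ≤ b) :
    ∀ n : ℕ, 0 ≤ lucasSeq x (-1) a b n
  | 0 => ha
  | 1 => hb
  | n + 2 => by
    have h₁ := lucasSeq_neg_one_nonneg hx ha hb (n + 1)
    have h₀ := lucasSeq_neg_one_nonneg hx ha hb n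
    rw [lucasSeq, neg_one_mul, sub_neg_eq_add]
    positivity

theorem lucasSeq_neg_one_pos {x a b : ℝ} (hx : 0 < x) (ha : 0 ≤ a) (hb : 0 < b) :
    ∀ {n : ℕ}, n ≠ 0 → 0 < lucasSeq x (-1) a b n
  | 1, _ => hb
  | n + 2, _ => by
    have h₁ := lucasSeq_neg_one_pos hx ha hb n.succ_ne_zero
    have h₀ := lucasSeq_neg_one_nonneg hx.le ha hb.le n
    rw [lucasSeq, neg_one_mul, sub_neg_eq_add]
    positivity

theorem lt_lucasSeq_neg_one_of_even {x a b : ℝ} (hx : 0 < x) (ha : 0 ≤ a) (hb : 0 < b) {n : ℕ}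
    (hn : n ≠ 0) (hn_even : Even n) : a < lucasSeq x (-1) a b n := by
  obtain ⟨k, rfl⟩ := hn_even.two_dvd
  have hstep (j : ℕ) : lucasSeq x (-1) a b (2 * j) < lucasSeq x (-1) a b (2 * (j + 1)) := by
    rw [mul_add_one, lucasSeq, neg_one_mul, sub_neg_eq_add]
    exact lt_add_of_pos_left _ (mul_pos hx (lucasSeq_neg_one_pos hx ha hb (2 * j).succ_ne_zero))
  exact strictMono_nat_of_lt_succ hstep (by omega : 0 < k)

theorem lucasSeq_I_mul (x a b : ℂ) (n : ℕ) :
    lucasSeq (Complex.I * x) 1 a (Complex.I * b) n =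
      Complex.I ^ n * lucasSeq x (-1) a b n := by
  simpa using lucasSeq_mul_sq x (-1) a b Complex.I n

theorem lucasV_I_mul (x : ℂ) (n : ℕ) :
    lucasV (Complex.I * x) 1 n = Complex.I ^ n * lucasV x (-1) n :=
  lucasSeq_I_mul x 2 x n

theorem I_mul_lucasU_I_mul (x : ℂ) (n : ℕ) :
    Complex.I * lucasU (Complex.I * x) 1 n = Complex.I ^ n * lucasU x (-1) n := by
  simpa [lucasU, ← lucasSeq_mul] using lucasSeq_I_mul x 0 1 n

end LucasSequence

section GainMatrix

open Matrix SimpleGraph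

/-- Square matrices with constant diagonal `z` that vanish off the diagonal and the edges of `G`,
and whose two entries on every edge are inverse to each other. The matrices `z I - A(Φ)`, for `Φ` a
unit gain graph on `G`, are of this form, and the form passes to induced subgraphs. -/
structure IsGainMatrix {R V : Type*} [CommRing R] (G : SimpleGraph V) (z : R) (M : Matrix V V R) :
    Prop where
  apply_self (v : V) : M v v = z
  apply_of_not_adj {u v : V} (huv : u ≠ v) (h : ¬ G.Adj u v) : M u v = 0
  apply_mul_apply {u v : V} (h : G.Adj u v) : M u v * M v u = 1

/-- The graph obtained from `H` by attaching a path with `k` vertices: its last vertex is joined to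
the vertex `v` of `H`. -/
def withTail {W : Type*} (H : SimpleGraph W) (v : W) (k : ℕ) : SimpleGraph (Fin k ⊕ W) where
  Adj
    | .inl i, .inl j => (pathGraph k).Adj i j
    | .inl i, .inr w => i.val + 1 = k ∧ w = v
    | .inr w, .inl i => i.val + 1 = k ∧ w = v
    | .inr w, .inr w' => H.Adj w w'
  symm := ⟨by rintro (i | i) (j | j) h <;> first | exact h.symm | exact h⟩
  loopless := ⟨by rintro (i | i) h <;> exact SimpleGraph.irrefl _ h⟩

/-- The free end of the path in `withTail H v k`, which is `v` itself if the path is empty. -/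
def tailEnd {W : Type*} (v : W) : (k : ℕ) → Fin k ⊕ W
  | 0 => .inr v
  | _ + 1 => .inl 0

theorem inl_eq_tailEnd_iff {W : Type*} {v : W} : ∀ {k : ℕ} {i : Fin k},
    .inl i = tailEnd v k ↔ i.val = 0
  | 0, i => i.elim0
  | k + 1, i => by simp [tailEnd]

theorem inr_eq_tailEnd_iff {W : Type*} {v w : W} : ∀ {k : ℕ},
    .inr w = tailEnd v k ↔ k = 0 ∧ w = v
  | 0 => by simp [tailEnd]
  | k + 1 => by simp [tailEnd]

theorem comap_succ_pathGraph (n : ℕ) : (pathGraph (n + 1)).comap Fin.succ = pathGraph n := by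
  ext i j
  simp [pathGraph_adj]

theorem comap_castSucc_pathGraph (n : ℕ) :
    (pathGraph (n + 1)).comap Fin.castSucc = pathGraph n := by
  ext i j
  simp [pathGraph_adj]

theorem comap_map_succ_withTail {W : Type*} (H : SimpleGraph W) (v : W) (k : ℕ) :
    (withTail H v (k + 1)).comap (Sum.map Fin.succ id) = withTail H v k := by
  ext (i | i) (j | j) <;> simp [withTail, pathGraph_adj]

theorem cycleGraph_adj_iff_val {n : ℕ} (i j : Fin (n + 3)) :
    (cycleGraph (n + 3)).Adj i j ↔ i.val + 1 = j.val ∨ j.val + 1 = i.val ∨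
      (i.val = 0 ∧ j.val = n + 2) ∨ (j.val = 0 ∧ i.val = n + 2) := by
  have hsub (a b : Fin (n + 3)) :
      (a - b).val = 1 ↔ b.val + 1 = a.val ∨ (a.val = 0 ∧ b.val = n + 2) := by
    rcases le_or_gt b a with h | h
    · rw [Fin.sub_val_of_le h]
      omega
    · rw [Fin.coe_sub_iff_lt.2 h]
      omega
  rw [cycleGraph_adj', hsub, hsub]
  tauto

theorem comap_succ_cycleGraph (n : ℕ) :
    (cycleGraph (n + 3)).comap Fin.succ = pathGraph (n + 2) := by
  ext i j
  simp only [comap_adj, cycleGraph_adj_iff_val, pathGraph_adj, Fin.val_succ]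
  omega

theorem prod_apply_finRotate {α : Type*} [CommMonoid α] {n : ℕ}
    (f : Fin (n + 1) → Fin (n + 1) → α) :
    ∏ i, f i (finRotate (n + 1) i) = (∏ i : Fin n, f i.castSucc i.succ) * f (Fin.last n) 0 := by
  simp [Fin.prod_univ_castSucc]

namespace IsGainMatrix

variable {R V W : Type*} [CommRing R] {z : R}

theorem submatrix {G : SimpleGraph V} {H : SimpleGraph W} {M : Matrix V V R}
    (hM : IsGainMatrix G z M) {f : W → V} (hf : f.Injective) (hfG : G.comap f = H) :
    IsGainMatrix H z (M.submatrix f f) := by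
  subst hfG
  exact ⟨fun _ => hM.apply_self _, fun hij h => hM.apply_of_not_adj (hf.ne hij) h,
    fun h => hM.apply_mul_apply h⟩

theorem transpose {G : SimpleGraph V} {M : Matrix V V R} (hM : IsGainMatrix G z M) :
    IsGainMatrix G z Mᵀ where
  apply_self := hM.apply_self
  apply_of_not_adj huv h := hM.apply_of_not_adj huv.symm (mt Adj.symm h)
  apply_mul_apply h := hM.apply_mul_apply h.symm

section Bridge

variable [DecidableEq V] [DecidableEq W] {G : SimpleGraph (V ⊕ W)}
  {M : Matrix (V ⊕ W) (V ⊕ W) R}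

theorem eq_fromBlocks_of_bridge (hM : IsGainMatrix G z M) {u : V} {v : W}
    (hG : ∀ i j, G.Adj (.inl i) (.inr j) ↔ i = u ∧ j = v) :
    M = fromBlocks (M.submatrix .inl .inl) (single u v (M (.inl u) (.inr v)))
      (single v u (M (.inr v) (.inl u))) (M.submatrix .inr .inr) := by
  ext (i | i) (j | j)
  · rfl
  · rw [fromBlocks_apply₁₂, single_apply]
    split_ifs with h
    · rw [h.1, h.2]
    · exact hM.apply_of_not_adj Sum.inl_ne_inr fun hadj => h <| by
        simpa [eq_comm] using (hG i j).1 hadj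
  · rw [fromBlocks_apply₂₁, single_apply]
    split_ifs with h
    · rw [h.1, h.2]
    · exact hM.apply_of_not_adj Sum.inr_ne_inl fun hadj => h <| by
        simpa [eq_comm, and_comm] using (hG j i).1 hadj.symm
  · rfl

theorem det_of_bridge [Fintype V] [Fintype W] (hM : IsGainMatrix G z M) {u : V} {v : W}
    (hG : ∀ i j, G.Adj (.inl i) (.inr j) ↔ i = u ∧ j = v) :
    M.det = (M.submatrix .inl .inl).det * (M.submatrix .inr .inr).det -
      (M.submatrix .inl .inl).adjugate u u * (M.submatrix .inr .inr).adjugate v v := by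
  have hbridge := hM.apply_mul_apply ((hG u v).2 ⟨rfl, rfl⟩)
  rw [hM.eq_fromBlocks_of_bridge hG, det_fromBlocks_single_single, hbridge, one_mul]
  rfl

end Bridge

section Path

theorem submatrix_succ_of_pathGraph {n : ℕ} {M : Matrix (Fin (n + 1)) (Fin (n + 1)) R}
    (hM : IsGainMatrix (pathGraph (n + 1)) z M) :
    IsGainMatrix (pathGraph n) z (M.submatrix Fin.succ Fin.succ) :=
  hM.submatrix (Fin.succ_injective n) (comap_succ_pathGraph n)

theorem submatrix_castSucc_of_pathGraph {n : ℕ} {M : Matrix (Fin (n + 1)) (Fin (n + 1)) R}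
    (hM : IsGainMatrix (pathGraph (n + 1)) z M) :
    IsGainMatrix (pathGraph n) z (M.submatrix Fin.castSucc Fin.castSucc) :=
  hM.submatrix (Fin.castSucc_injective n) (comap_castSucc_pathGraph n)

theorem det_of_pathGraph : ∀ {n : ℕ} {M : Matrix (Fin n) (Fin n) R},
    IsGainMatrix (pathGraph n) z M → M.det = lucasU z 1 (n + 1)
  | 0, M, _ => by simp [lucasU, lucasSeq]
  | 1, M, hM => by simp [lucasU, lucasSeq, hM.apply_self]
  | n + 2, M, hM => by
    have hrow (i : Fin n) : M 0 i.succ.succ = 0 :=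
      hM.apply_of_not_adj (Fin.succ_ne_zero _).symm (by simp [pathGraph_adj])
    have hcol (i : Fin n) : M i.succ.succ 0 = 0 :=
      hM.apply_of_not_adj (Fin.succ_ne_zero _) (by simp [pathGraph_adj])
    have hedge : M 0 (Fin.succ 0) * M (Fin.succ 0) 0 = 1 :=
      hM.apply_mul_apply (by simp [pathGraph_adj])
    have hadj : (M.submatrix Fin.succ Fin.succ).adjugate 0 0 =
        ((M.submatrix Fin.succ Fin.succ).submatrix Fin.succ Fin.succ).det := by
      simp [adjugate_fin_succ_eq_det_submatrix]
    rw [det_eq_mul_det_sub_sum_adjugate]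
    simp only [Fin.sum_univ_succ, hrow, hcol, zero_mul, mul_zero, Finset.sum_const_zero, add_zero]
    rw [hadj, det_of_pathGraph hM.submatrix_succ_of_pathGraph,
      det_of_pathGraph hM.submatrix_succ_of_pathGraph.submatrix_succ_of_pathGraph, hM.apply_self]
    have hrec : lucasU z 1 (n + 3) =
        z * lucasU z 1 (n + 2) - 1 * lucasU z 1 (n + 1) := rfl
    linear_combination -lucasU z 1 (n + 1) * hedge - hrec

variable {n : ℕ} {M : Matrix (Fin (n + 1)) (Fin (n + 1)) R}

theorem adjugate_zero_zero_of_pathGraph (hM : IsGainMatrix (pathGraph (n + 1)) z M) :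
    M.adjugate 0 0 = lucasU z 1 (n + 1) := by
  rw [← det_of_pathGraph hM.submatrix_succ_of_pathGraph]
  simp [adjugate_fin_succ_eq_det_submatrix]

theorem adjugate_last_last_of_pathGraph (hM : IsGainMatrix (pathGraph (n + 1)) z M) :
    M.adjugate (Fin.last n) (Fin.last n) = lucasU z 1 (n + 1) := by
  rw [← det_of_pathGraph hM.submatrix_castSucc_of_pathGraph]
  simp [adjugate_fin_succ_eq_det_submatrix, Fin.succAbove_last, ← two_mul]

theorem adjugate_zero_last_of_pathGraph (hM : IsGainMatrix (pathGraph (n + 1)) z M) :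
    M.adjugate 0 (Fin.last n) = (-1) ^ n * ∏ i : Fin n, M i.castSucc i.succ := by
  have hlower : (M.submatrix Fin.castSucc Fin.succ).IsLowerTriangular := fun i j hij => by
    have hij : i.val < j.val := hij
    refine hM.apply_of_not_adj (Fin.ne_of_val_ne ?_) ?_
    · rw [Fin.val_castSucc, Fin.val_succ]
      omega
    · rw [pathGraph_adj, Fin.val_succ, Fin.val_castSucc]
      omega
  rw [adjugate_fin_succ_eq_det_submatrix, Fin.succAbove_last, Fin.succAbove_zero,
    det_of_isLowerTriangular _ hlower]
  simp

theorem adjugate_last_zero_of_pathGraph (hM : IsGainMatrix (pathGraph (n + 1)) z M) :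
    M.adjugate (Fin.last n) 0 = (-1) ^ n * ∏ i : Fin n, M i.succ i.castSucc := by
  simpa [← adjugate_transpose] using hM.transpose.adjugate_zero_last_of_pathGraph

end Path

section Cycle

variable {n : ℕ} {M : Matrix (Fin (n + 3)) (Fin (n + 3)) R}

theorem submatrix_succ_of_cycleGraph (hM : IsGainMatrix (cycleGraph (n + 3)) z M) :
    IsGainMatrix (pathGraph (n + 2)) z (M.submatrix Fin.succ Fin.succ) :=
  hM.submatrix (Fin.succ_injective _) (comap_succ_cycleGraph n)

theorem adjugate_zero_zero_of_cycleGraph (hM : IsGainMatrix (cycleGraph (n + 3)) z M) :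
    M.adjugate 0 0 = lucasU z 1 (n + 3) := by
  rw [← det_of_pathGraph hM.submatrix_succ_of_cycleGraph]
  simp [adjugate_fin_succ_eq_det_submatrix]

theorem apply_zero_succ_of_cycleGraph (hM : IsGainMatrix (cycleGraph (n + 3)) z M)
    (i : Fin (n + 2)) (hi : i ≠ 0 ∧ i ≠ Fin.last (n + 1)) : M 0 i.succ = 0 := by
  refine hM.apply_of_not_adj (Fin.succ_ne_zero i).symm fun h => ?_
  rw [cycleGraph_adj_iff_val] at h
  simp only [ne_eq, Fin.ext_iff, Fin.val_zero, Fin.val_last, Fin.val_succ] at hi h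
  omega

theorem apply_zero_mul_apply_of_cycleGraph (hM : IsGainMatrix (cycleGraph (n + 3)) z M) :
    M 0 (Fin.succ 0) * M (Fin.succ 0) 0 = 1 ∧
      M 0 (Fin.last (n + 1)).succ * M (Fin.last (n + 1)).succ 0 = 1 :=
  ⟨hM.apply_mul_apply (by simp [cycleGraph_adj_iff_val]),
    hM.apply_mul_apply (by simp [cycleGraph_adj_iff_val])⟩

theorem sum_apply_mul_apply_of_cycleGraph (hM : IsGainMatrix (cycleGraph (n + 3)) z M)
    (N : Matrix (Fin (n + 2)) (Fin (n + 2)) R) :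
    ∑ i, ∑ j, M 0 i.succ * N i j * M j.succ 0 =
      N 0 0 + N (Fin.last (n + 1)) (Fin.last (n + 1)) +
      (M 0 (Fin.succ 0) * N 0 (Fin.last (n + 1)) * M (Fin.last (n + 1)).succ 0 +
      M (Fin.succ 0) 0 * N (Fin.last (n + 1)) 0 * M 0 (Fin.last (n + 1)).succ) := by
  have hrow := hM.apply_zero_succ_of_cycleGraph
  have hcol := hM.transpose.apply_zero_succ_of_cycleGraph
  simp only [transpose_apply] at hcol
  have hends : (0 : Fin (n + 2)) ≠ Fin.last (n + 1) := Fin.last_pos.ne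
  have hsum (i : Fin (n + 2)) : ∑ j, M 0 i.succ * N i j * M j.succ 0 =
      M 0 i.succ * N i 0 * M (Fin.succ 0) 0 +
        M 0 i.succ * N i (Fin.last _) * M (Fin.last _).succ 0 :=
    Fintype.sum_eq_add _ _ hends fun j hj => by rw [hcol j hj, mul_zero]
  rw [Fintype.sum_eq_add _ _ hends fun i hi => by simp [hrow i hi], hsum, hsum]
  obtain ⟨hfirst, hlast⟩ := hM.apply_zero_mul_apply_of_cycleGraph
  linear_combination N 0 0 * hfirst + N (Fin.last _) (Fin.last _) * hlast

theorem det_of_cycleGraph (hM : IsGainMatrix (cycleGraph (n + 3)) z M) :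
    M.det = lucasV z 1 (n + 3) - (-1) ^ (n + 3) *
      (∏ i, M i (finRotate _ i) + ∏ i, M (finRotate _ i) i) := by
  have hpath := hM.submatrix_succ_of_cycleGraph
  rw [det_eq_mul_det_sub_sum_adjugate, hM.sum_apply_mul_apply_of_cycleGraph,
    det_of_pathGraph hpath, hpath.adjugate_zero_zero_of_pathGraph,
    hpath.adjugate_last_last_of_pathGraph, hpath.adjugate_zero_last_of_pathGraph,
    hpath.adjugate_last_zero_of_pathGraph, hM.apply_self, lucasV, lucasSeq_succ_eq,
    prod_apply_finRotate M, prod_apply_finRotate fun i j => M j i]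
  simp only [Fin.prod_univ_succ (n := n + 1), submatrix_apply, Fin.castSucc_zero,
    ← Fin.succ_castSucc, Fin.succ_last]
  ring

end Cycle

section Tail

variable {W : Type*} [Fintype W] [DecidableEq W] {H : SimpleGraph W} {v : W}

theorem det_of_withTail : ∀ {k : ℕ} {M : Matrix (Fin k ⊕ W) (Fin k ⊕ W) R},
    IsGainMatrix (withTail H v k) z M →
    M.det = lucasSeq z 1 ((M.submatrix .inr .inr).adjugate v v) (M.submatrix .inr .inr).det (k + 1)
  | 0, M, _ => (det_submatrix_equiv_self (Equiv.emptySum (Fin 0) W).symm M).symm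
  | k + 1, M, hM => by
    have hpath : IsGainMatrix (pathGraph (k + 1)) z (M.submatrix .inl .inl) :=
      hM.submatrix Sum.inl_injective rfl
    rw [hM.det_of_bridge (u := Fin.last k) (v := v) fun i w => by
      simp [withTail, Fin.ext_iff], hpath.det_of_pathGraph,
      hpath.adjugate_last_last_of_pathGraph,
      lucasSeq_succ_eq z 1 _ (M.submatrix .inr .inr).det]
    ring

theorem adjugate_tailEnd_of_withTail : ∀ {k : ℕ} {M : Matrix (Fin k ⊕ W) (Fin k ⊕ W) R},
    IsGainMatrix (withTail H v k) z M →
    M.adjugate (tailEnd v k) (tailEnd v k) =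
      lucasSeq z 1 ((M.submatrix .inr .inr).adjugate v v) (M.submatrix .inr .inr).det k
  | 0, M, _ => by
    change (M.adjugate.submatrix (Equiv.emptySum (Fin 0) W).symm
      (Equiv.emptySum (Fin 0) W).symm) v v = _
    rw [← adjugate_submatrix_equiv_self]
    rfl
  | k + 1, M, hM => by
    have hrange : Set.range (Sum.map Fin.succ id : Fin k ⊕ W → Fin (k + 1) ⊕ W) =
        {tailEnd v (k + 1)}ᶜ := by
      ext (i | w)
      · simp [tailEnd]
      · simp [tailEnd]
    have hinj : (Sum.map Fin.succ id : Fin k ⊕ W → Fin (k + 1) ⊕ W).Injective :=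
      (Fin.succ_injective k).sumMap Function.injective_id
    rw [adjugate_apply_self_eq_det_submatrix M hinj hrange]
    exact det_of_withTail (hM.submatrix hinj (comap_map_succ_withTail H v k))

end Tail

end IsGainMatrix

end GainMatrix

section CharMatrix

open Matrix SimpleGraph

namespace UnitGainGraph

variable {V : Type*} {G : SimpleGraph V} (Φ : UnitGainGraph G)

theorem coe_cycleGain {k : ℕ} (hk : 3 ≤ k) (c : Copy (cycleGraph k) G) :
    (Φ.cycleGain hk c : ℂ) = ∏ i, (Φ.gain
      ⟨(c i, c (finRotate k i)), c.toHom.map_adj (cycleGraph_adj_finRotate hk i)⟩ : ℂ) :=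
  map_prod Circle.coeHom _ _

variable [Fintype V] [DecidableEq V] (z : ℂ)

theorem charMatrix_apply_of_adj {u v : V} (h : G.Adj u v) :
    Φ.charMatrix z u v = -Φ.gain ⟨(u, v), h⟩ := by
  simp [charMatrix, adjMatrix, h, h.ne]

theorem charMatrix_apply_of_adj_symm {u v : V} (h : G.Adj u v) :
    Φ.charMatrix z v u = -(Φ.gain ⟨(u, v), h⟩ : ℂ)⁻¹ := by
  rw [Φ.charMatrix_apply_of_adj z h.symm, ← Circle.coe_inv, ← Φ.gain_symm]
  rfl

theorem isGainMatrix_charMatrix : IsGainMatrix G z (Φ.charMatrix z) where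
  apply_self v := by simp [charMatrix, adjMatrix]
  apply_of_not_adj huv h := by simp [charMatrix, adjMatrix, huv, h]
  apply_mul_apply h := by
    rw [Φ.charMatrix_apply_of_adj z h, Φ.charMatrix_apply_of_adj_symm z h, neg_mul_neg,
      mul_inv_cancel₀ (Circle.coe_ne_zero _)]

section Cycle

variable {k : ℕ} (hk : 3 ≤ k) (c : Copy (cycleGraph k) G)

theorem prod_charMatrix_apply_finRotate :
    ∏ i, Φ.charMatrix z (c i) (c (finRotate k i)) = (-1) ^ k * Φ.cycleGain hk c := by
  rw [coe_cycleGain, ← Fin.prod_const, ← Finset.prod_mul_distrib]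
  refine Finset.prod_congr rfl fun i _ => ?_
  rw [neg_one_mul]
  exact Φ.charMatrix_apply_of_adj z _

theorem prod_charMatrix_finRotate_apply :
    ∏ i, Φ.charMatrix z (c (finRotate k i)) (c i) = (-1) ^ k * (Φ.cycleGain hk c : ℂ)⁻¹ := by
  rw [coe_cycleGain, ← Finset.prod_inv_distrib, ← Fin.prod_const, ← Finset.prod_mul_distrib]
  refine Finset.prod_congr rfl fun i _ => ?_
  rw [neg_one_mul]
  exact Φ.charMatrix_apply_of_adj_symm z _

theorem prod_charMatrix_add_prod_charMatrix :
    (-1) ^ k * (∏ i, Φ.charMatrix z (c i) (c (finRotate k i)) +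
      ∏ i, Φ.charMatrix z (c (finRotate k i)) (c i)) = 2 * (Φ.cycleGain hk c : ℂ).re := by
  rw [Φ.prod_charMatrix_apply_finRotate z hk, Φ.prod_charMatrix_finRotate_apply z hk, ← mul_add,
    ← mul_assoc, ← mul_pow, ← Circle.coe_inv, Circle.coe_inv_eq_conj, Complex.add_conj]
  simp

end Cycle

section InducedCycle

variable {n : ℕ} {c : Copy (cycleGraph (n + 3)) G} (hc : G.comap c = cycleGraph (n + 3))
include hc

theorem isGainMatrix_charMatrix_submatrix_cycle :
    IsGainMatrix (cycleGraph (n + 3)) z ((Φ.charMatrix z).submatrix c c) :=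
  (Φ.isGainMatrix_charMatrix z).submatrix c.injective hc

theorem det_charMatrix_submatrix_cycle (hn : 3 ≤ n + 3) :
    ((Φ.charMatrix z).submatrix c c).det =
      lucasV z 1 (n + 3) - 2 * (Φ.cycleGain hn c : ℂ).re := by
  rw [(Φ.isGainMatrix_charMatrix_submatrix_cycle z hc).det_of_cycleGraph,
    ← Φ.prod_charMatrix_add_prod_charMatrix z hn c]
  rfl

theorem adjugate_charMatrix_submatrix_cycle :
    ((Φ.charMatrix z).submatrix c c).adjugate 0 0 = lucasU z 1 (n + 3) :=
  (Φ.isGainMatrix_charMatrix_submatrix_cycle z hc).adjugate_zero_zero_of_cycleGraph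

end InducedCycle

end UnitGainGraph

end CharMatrix

section Dumbbell

open SimpleGraph

theorem neg_I_pow_of_even {n : ℕ} (hn : Even n) : (-Complex.I) ^ n = (-1) ^ (n / 2) := by
  obtain ⟨k, rfl⟩ := hn.two_dvd
  rw [pow_mul, neg_sq, Complex.I_sq, Nat.mul_div_cancel_left k two_pos]

theorem neg_I_pow_of_odd {n : ℕ} (hn : Odd n) :
    (-Complex.I) ^ n = (-1) ^ ((n + 1) / 2) * Complex.I := by
  rw [← neg_I_pow_of_even hn.add_one, pow_succ, mul_assoc]
  simp

theorem comap_inr_dumbbellGraph (r m ℓ : ℕ) :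
    (dumbbellGraph r (m + 1) ℓ).comap .inr = withTail (cycleGraph (m + 1)) 0 (ℓ - 1) := by
  ext (i | i) (j | j) <;> simp [dumbbellGraph, dumbbellAdj, withTail]

theorem dumbbellGraph_adj_inl_inr {n m ℓ : ℕ} (hℓ : 1 ≤ ℓ) (i : Fin (n + 1))
    (u : Fin (ℓ - 1) ⊕ Fin (m + 1)) :
    (dumbbellGraph (n + 1) (m + 1) ℓ).Adj (.inl i) (.inr u) ↔ i = 0 ∧ u = tailEnd 0 (ℓ - 1) := by
  rcases u with u | u
  · rw [inl_eq_tailEnd_iff]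
    exact and_congr_left' Fin.val_eq_zero_iff
  · have hℓ' : ℓ = 1 ↔ ℓ - 1 = 0 := by omega
    rw [inr_eq_tailEnd_iff, ← hℓ']
    simp [dumbbellGraph, dumbbellAdj, and_left_comm]

namespace UnitGainGraph

theorem det_charMatrix_dumbbell {r s ℓ : ℕ} (hr : 3 ≤ r) (hs : 3 ≤ s) (hℓ : 1 ≤ ℓ)
    (Φ : UnitGainGraph (dumbbellGraph r s ℓ)) (z : ℂ) :
    (Φ.charMatrix z).det =
      (lucasV z 1 r - 2 * (Φ.cycleGain hr (dumbbellLeftCycle r s ℓ) : ℂ).re) *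
        lucasSeq z 1 (lucasU z 1 s)
          (lucasV z 1 s - 2 * (Φ.cycleGain hs (dumbbellRightCycle r s ℓ) : ℂ).re) ℓ -
      lucasU z 1 r * lucasSeq z 1 (lucasU z 1 s)
        (lucasV z 1 s - 2 * (Φ.cycleGain hs (dumbbellRightCycle r s ℓ) : ℂ).re) (ℓ - 1) := by
  obtain ⟨n, rfl⟩ := Nat.exists_eq_add_of_le' hr
  obtain ⟨m, rfl⟩ := Nat.exists_eq_add_of_le' hs
  have hleft : (dumbbellGraph (n + 3) (m + 3) ℓ).comap (dumbbellLeftCycle _ _ _) =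
    cycleGraph (n + 3) := rfl
  have hright : (dumbbellGraph (n + 3) (m + 3) ℓ).comap (dumbbellRightCycle _ _ _) =
    cycleGraph (m + 3) := rfl
  have hM := Φ.isGainMatrix_charMatrix z
  have htail : IsGainMatrix (withTail (cycleGraph (m + 3)) 0 (ℓ - 1)) z
      ((Φ.charMatrix z).submatrix .inr .inr) :=
    hM.submatrix Sum.inr_injective (comap_inr_dumbbellGraph (n + 3) (m + 2) ℓ)
  rw [hM.det_of_bridge (dumbbellGraph_adj_inl_inr hℓ), htail.det_of_withTail,
    htail.adjugate_tailEnd_of_withTail, Nat.sub_add_cancel hℓ,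
    ← Φ.det_charMatrix_submatrix_cycle z hleft hr, ← Φ.adjugate_charMatrix_submatrix_cycle z hleft,
    ← Φ.det_charMatrix_submatrix_cycle z hright hs,
    ← Φ.adjugate_charMatrix_submatrix_cycle z hright]
  rfl

theorem I_mul_det_charMatrix_I_mul_dumbbell {r s ℓ : ℕ} (hr : 3 ≤ r) (hs : 3 ≤ s) (hℓ : 1 ≤ ℓ)
    (Φ : UnitGainGraph (dumbbellGraph r s ℓ)) (x : ℂ) {γr γs : ℝ}
    (hγr : (Φ.cycleGain hr (dumbbellLeftCycle r s ℓ) : ℂ).re = γr)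
    (hγs : (Φ.cycleGain hs (dumbbellRightCycle r s ℓ) : ℂ).re = γs) :
    Complex.I * (Φ.charMatrix (Complex.I * x)).det = Complex.I ^ (r + s + ℓ) *
      ((lucasV x (-1) r - 2 * ((-Complex.I) ^ r * γr)) * lucasSeq x (-1) (lucasU x (-1) s)
          (lucasV x (-1) s - 2 * ((-Complex.I) ^ s * γs)) ℓ +
        lucasU x (-1) r * lucasSeq x (-1) (lucasU x (-1) s)
          (lucasV x (-1) s - 2 * ((-Complex.I) ^ s * γs)) (ℓ - 1)) := by
  have hcycle (k : ℕ) (γ : ℂ) : lucasV (Complex.I * x) 1 k - 2 * γ =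
      Complex.I ^ k * (lucasV x (-1) k - 2 * ((-Complex.I) ^ k * γ)) := by
    have hI : Complex.I ^ k * (-Complex.I) ^ k = 1 := by simp [← mul_pow]
    rw [lucasV_I_mul]
    linear_combination 2 * γ * hI
  set A := lucasSeq (Complex.I * x) 1 (lucasU (Complex.I * x) 1 s)
    (lucasV (Complex.I * x) 1 s - 2 * γs)
  set A' := lucasSeq x (-1) (lucasU x (-1) s) (lucasV x (-1) s - 2 * ((-Complex.I) ^ s * γs))
  have htail (n : ℕ) : Complex.I * A n = Complex.I ^ (s + n) * A' n := by
    rw [← lucasSeq_mul, I_mul_lucasU_I_mul, hcycle, lucasSeq_I_mul, lucasSeq_mul]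
    ring
  obtain ⟨k, rfl⟩ := Nat.exists_eq_add_of_le' hℓ
  rw [det_charMatrix_dumbbell hr hs hℓ, hγr, hγs, hcycle r, Nat.add_sub_cancel]
  linear_combination
    Complex.I ^ r * (lucasV x (-1) r - 2 * ((-Complex.I) ^ r * γr)) * htail (k + 1) +
      Complex.I ^ 2 * A k * I_mul_lucasU_I_mul x r +
      Complex.I ^ (r + 1) * lucasU x (-1) r * htail k -
      Complex.I * lucasU (Complex.I * x) 1 r * A k * Complex.I_sq

theorem normSq_det_charMatrix_dumbbell {r s ℓ : ℕ} (hr : 3 ≤ r) (hs : 3 ≤ s) (hℓ : 1 ≤ ℓ)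
    (hr_even : Even r) (hs_odd : Odd s) (Φ : UnitGainGraph (dumbbellGraph r s ℓ)) (x : ℝ) :
    Complex.normSq (Φ.charMatrix (Complex.I * x)).det =
      ((lucasV x (-1) r - 2 * mixedAlpha hr Φ) *
          lucasSeq x (-1) (lucasU x (-1) s) (lucasV x (-1) s) ℓ +
        lucasU x (-1) r * lucasSeq x (-1) (lucasU x (-1) s) (lucasV x (-1) s) (ℓ - 1)) ^ 2 +
      4 * mixedBeta hs Φ ^ 2 * ((lucasV x (-1) r - 2 * mixedAlpha hr Φ) * lucasU x (-1) ℓ +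
        lucasU x (-1) r * lucasU x (-1) (ℓ - 1)) ^ 2 := by
  have hα : (-Complex.I) ^ r * ((Φ.cycleGain hr (dumbbellLeftCycle r s ℓ) : ℂ).re : ℂ) =
      mixedAlpha hr Φ := by
    rw [neg_I_pow_of_even hr_even, mixedAlpha]
    push_cast
    rfl
  have hβ : (-Complex.I) ^ s * ((Φ.cycleGain hs (dumbbellRightCycle r s ℓ) : ℂ).re : ℂ) =
      mixedBeta hs Φ * Complex.I := by
    rw [neg_I_pow_of_odd hs_odd, mixedBeta]
    push_cast
    ring
  set p := lucasV x (-1) r - 2 * mixedAlpha hr Φ with hp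
  set a := lucasSeq x (-1) (lucasU x (-1) s) (lucasV x (-1) s) with ha
  set u := lucasU x (-1) with hu
  have hdet : Complex.I * (Φ.charMatrix (Complex.I * x)).det = Complex.I ^ (r + s + ℓ) *
      ((p * a ℓ + u r * a (ℓ - 1) : ℝ) +
        (-(2 * mixedBeta hs Φ * (p * u ℓ + u r * u (ℓ - 1))) : ℝ) * Complex.I) := by
    rw [I_mul_det_charMatrix_I_mul_dumbbell hr hs hℓ Φ x rfl rfl, hα, hβ, lucasSeq_sub,
      lucasSeq_sub, hp, ha, hu]
    push_cast
    ring
  rw [← one_mul (Complex.normSq _), ← Complex.normSq_I, ← map_mul, hdet, map_mul, map_pow,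
    Complex.normSq_I, one_pow, one_mul, Complex.normSq_add_mul_I]
  ring

section OfFun

variable {V : Type*} {G : SimpleGraph V}

/-- The unit gain graph on `G` in which the edge `u → v` has gain `g u v / g v u`. -/
noncomputable def ofFun (G : SimpleGraph V) (g : V → V → Circle) : UnitGainGraph G where
  gain d := g d.fst d.snd / g d.snd d.fst
  gain_symm _ := (inv_div _ _).symm

theorem cycleGain_ofFun {n : ℕ} (hn : 3 ≤ n + 3) (c : Copy (cycleGraph (n + 3)) G)
    {g : V → V → Circle} {w : Circle}
    (hg : ∀ i j, g (c i) (c j) = if i = Fin.last (n + 2) ∧ j = 0 then w else 1) :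
    (ofFun G g).cycleGain hn c = w := by
  have hgain (i : Fin (n + 3)) : g (c i) (c (finRotate _ i)) / g (c (finRotate _ i)) (c i) =
      if i = Fin.last (n + 2) then w else 1 := by
    rw [hg, hg]
    rcases eq_or_ne i (Fin.last (n + 2)) with rfl | hi
    · simp
    · have hi_rotate : ¬ (finRotate (n + 3) i = Fin.last (n + 2) ∧ i = 0) := by
        rintro ⟨h, rfl⟩
        simp [Fin.ext_iff] at h
      rw [if_neg hi_rotate, if_neg hi, if_neg fun h => hi h.1, div_one]
  calc (ofFun G g).cycleGain hn c
      = ∏ i, if i = Fin.last (n + 2) then w else 1 := Finset.prod_congr rfl fun i _ => hgain i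
    _ = w := by simp

end OfFun

theorem exists_cycleGain_dumbbell_eq {r s ℓ : ℕ} (hr : 3 ≤ r) (hs : 3 ≤ s) (w w' : Circle) :
    ∃ Φ : UnitGainGraph (dumbbellGraph r s ℓ), Φ.cycleGain hr (dumbbellLeftCycle r s ℓ) = w ∧
      Φ.cycleGain hs (dumbbellRightCycle r s ℓ) = w' := by
  obtain ⟨n, rfl⟩ := Nat.exists_eq_add_of_le' hr
  obtain ⟨m, rfl⟩ := Nat.exists_eq_add_of_le' hs
  let g : DumbbellVertex (n + 3) (m + 3) ℓ → DumbbellVertex (n + 3) (m + 3) ℓ → Circle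
    | .inl i, .inl j => if i = Fin.last (n + 2) ∧ j = 0 then w else 1
    | .inr (.inr i), .inr (.inr j) => if i = Fin.last (m + 2) ∧ j = 0 then w' else 1
    | _, _ => 1
  exact ⟨ofFun _ g, cycleGain_ofFun hr _ fun _ _ => rfl, cycleGain_ofFun hs _ fun _ _ => rfl⟩

end UnitGainGraph

theorem exists_circle_re_eq {t : ℝ} (ht : |t| ≤ 1) : ∃ w : Circle, (w : ℂ).re = t :=
  ⟨Circle.exp (Real.arccos t), by
    rw [Circle.coe_exp, Complex.exp_ofReal_mul_I_re,
      Real.cos_arccos (abs_le.1 ht).1 (abs_le.1 ht).2]⟩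

theorem exists_mixedAlpha_eq_one_mixedBeta_eq_zero {r s ℓ : ℕ} (hr : 3 ≤ r) (hs : 3 ≤ s) :
    ∃ Φ : UnitGainGraph (dumbbellGraph r s ℓ), mixedAlpha hr Φ = 1 ∧ mixedBeta hs Φ = 0 := by
  obtain ⟨w, hw⟩ := exists_circle_re_eq (t := (-1) ^ (r / 2)) (by simp)
  obtain ⟨w', hw'⟩ := exists_circle_re_eq (t := 0) (by simp)
  obtain ⟨Φ, hr_gain, hs_gain⟩ :=
    UnitGainGraph.exists_cycleGain_dumbbell_eq (ℓ := ℓ) hr hs w w'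
  refine ⟨Φ, ?_, ?_⟩
  · rw [mixedAlpha, hr_gain, hw, ← mul_pow]
    simp
  · rw [mixedBeta, hs_gain, hw', mul_zero]

theorem mixedAlpha_le_one {r s ℓ : ℕ} (hr : 3 ≤ r) (Φ : UnitGainGraph (dumbbellGraph r s ℓ)) :
    mixedAlpha hr Φ ≤ 1 := by
  refine (le_abs_self _).trans ?_
  rw [mixedAlpha, abs_mul, abs_pow, abs_neg, abs_one, one_pow, one_mul]
  exact (Complex.abs_re_le_norm _).trans (Circle.norm_coe _).le

theorem sq_lt_sq_add_of_ne {c p a e q q' α β : ℝ} (hc : 2 < c) (hp : 0 ≤ p) (ha : 0 < a)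
    (he : 0 ≤ e) (hq : 0 < q) (hq' : 0 ≤ q') (hα : α ≤ 1) (h : ¬ (α = 1 ∧ β = 0)) :
    ((c - 2) * a + p * e) ^ 2 <
      ((c - 2 * α) * a + p * e) ^ 2 + 4 * β ^ 2 * ((c - 2 * α) * q + p * q') ^ 2 := by
  have hc₁ : 0 < c - 2 := by linarith
  have hcα : 0 < c - 2 * α := by linarith
  rcases hα.lt_or_eq with hα | rfl
  · have hlt : (c - 2) * a + p * e < (c - 2 * α) * a + p * e := by
      gcongr
      linarith
    exact lt_add_of_lt_of_nonneg (pow_lt_pow_left₀ hlt (add_nonneg (mul_pos hc₁ ha).le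
      (mul_nonneg hp he)) two_ne_zero) (by positivity)
  · have hβ : β ≠ 0 := fun hβ => h ⟨rfl, hβ⟩
    rw [mul_one] at hcα ⊢
    exact lt_add_of_pos_right _ (by positivity)

theorem energy_eq_of_mixedAlpha_eq_of_mixedBeta_eq {r s ℓ : ℕ} (hr : 3 ≤ r) (hs : 3 ≤ s)
    (hℓ : 1 ≤ ℓ) (hr_even : Even r) (hs_odd : Odd s) {Φ Ψ : UnitGainGraph (dumbbellGraph r s ℓ)}
    (hα : mixedAlpha hr Φ = mixedAlpha hr Ψ) (hβ : mixedBeta hs Φ = mixedBeta hs Ψ) :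
    Φ.energy = Ψ.energy :=
  UnitGainGraph.energy_eq_of_normSq_det_charMatrix_eq fun x _ => by
    rw [UnitGainGraph.normSq_det_charMatrix_dumbbell hr hs hℓ hr_even hs_odd,
      UnitGainGraph.normSq_det_charMatrix_dumbbell hr hs hℓ hr_even hs_odd, hα, hβ]

theorem energy_lt_of_mixedAlpha_eq_one_of_mixedBeta_eq_zero {r s ℓ : ℕ} (hr : 3 ≤ r) (hs : 3 ≤ s)
    (hℓ : 1 ≤ ℓ) (hr_even : Even r) (hs_odd : Odd s) {Φ Ψ : UnitGainGraph (dumbbellGraph r s ℓ)}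
    (hα : mixedAlpha hr Φ = 1) (hβ : mixedBeta hs Φ = 0)
    (hΨ : ¬ (mixedAlpha hr Ψ = 1 ∧ mixedBeta hs Ψ = 0)) : Φ.energy < Ψ.energy := by
  refine UnitGainGraph.energy_lt_of_normSq_det_charMatrix_lt fun x hx => ?_
  have hu (n : ℕ) : 0 ≤ lucasU x (-1) n := lucasSeq_neg_one_nonneg hx.le le_rfl zero_le_one n
  have hv : 0 < lucasV x (-1) s := lucasSeq_neg_one_pos hx zero_le_two hx (by omega)
  rw [UnitGainGraph.normSq_det_charMatrix_dumbbell hr hs hℓ hr_even hs_odd,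
    UnitGainGraph.normSq_det_charMatrix_dumbbell hr hs hℓ hr_even hs_odd, hα, hβ, mul_one,
    zero_pow two_ne_zero, mul_zero, zero_mul, add_zero]
  exact sq_lt_sq_add_of_ne
    (lt_lucasSeq_neg_one_of_even hx zero_le_two hx (by omega) hr_even) (hu r)
    (lucasSeq_neg_one_pos hx (hu s) hv (by omega)) (lucasSeq_neg_one_nonneg hx.le (hu s) hv.le _)
    (lucasSeq_neg_one_pos hx le_rfl one_pos (by omega)) (hu _) (mixedAlpha_le_one hr Ψ) hΨ

end Dumbbell

theorem mainTheorem8 (r s ℓ : ℕ) (hr : 3 ≤ r) (hs : 3 ≤ s) (hℓ : 1 ≤ ℓ)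
    (hr_even : Even r) (hs_odd : Odd s) :
    (∃ Φ : UnitGainGraph (dumbbellGraph r s ℓ),
      ∀ Ψ : UnitGainGraph (dumbbellGraph r s ℓ), Φ.energy ≤ Ψ.energy) ∧
    ∀ Φ : UnitGainGraph (dumbbellGraph r s ℓ),
      (∀ Ψ : UnitGainGraph (dumbbellGraph r s ℓ), Φ.energy ≤ Ψ.energy) ↔
        mixedAlpha hr Φ = 1 ∧ mixedBeta hs Φ = 0 := by
  have hmin (Φ : UnitGainGraph (dumbbellGraph r s ℓ))
      (hΦ : mixedAlpha hr Φ = 1 ∧ mixedBeta hs Φ = 0) (Ψ : UnitGainGraph (dumbbellGraph r s ℓ)) :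
      Φ.energy ≤ Ψ.energy := by
    by_cases hΨ : mixedAlpha hr Ψ = 1 ∧ mixedBeta hs Ψ = 0
    · exact (energy_eq_of_mixedAlpha_eq_of_mixedBeta_eq hr hs hℓ hr_even hs_odd
        (hΦ.1.trans hΨ.1.symm) (hΦ.2.trans hΨ.2.symm)).le
    · exact (energy_lt_of_mixedAlpha_eq_one_of_mixedBeta_eq_zero hr hs hℓ hr_even hs_odd
        hΦ.1 hΦ.2 hΨ).le
  obtain ⟨Φ₀, hΦ₀⟩ := exists_mixedAlpha_eq_one_mixedBeta_eq_zero (ℓ := ℓ) hr hs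
  refine ⟨⟨Φ₀, hmin Φ₀ hΦ₀⟩, fun Φ => ⟨fun hΦ => ?_, hmin Φ⟩⟩
  by_contra hne
  exact (hΦ Φ₀).not_gt (energy_lt_of_mixedAlpha_eq_one_of_mixedBeta_eq_zero hr hs hℓ hr_even
    hs_odd hΦ₀.1 hΦ₀.2 hne)
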